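/- Let $R$ be a ring with identity (not necessarily commutative) with centre $Z(R)$, let $M$ be a finitely generated semisimple unitary left $R$-module, and let $\varphi:M\to M$ be a nilpotent $R$-endomorphism. Let $\mathrm{Cen}(\varphi)=\{\psi\in\mathrm{Hom}_R(M,M)\mid \psi\circ\varphi=\varphi\circ\psi\}$, regarded as a $Z(R)$-subalgebra of $\mathrm{Hom}_R(M,M)$ (with composition as product), and let $m=\dim_R(\ker\varphi)$ be the composition length of $\ker\varphi$, which is finite. For a $Z(R)$-algebra $A$ and $f\in Z(R)\langle x_1,x_2,\dots\rangle$ (the free associative unital algebra), say that $A$ satisfies the identity $f=0$ if $f$ vanishes under every substitution of elements of $A$ for the variables. (1) If $f\in Z(R)\langle x_1,x_2,\dots\rangle$ and the $Z(R)$-algebra $M_m^{\mathrm{op}}(R[z])$, the opposite of the algebra of $m\times m$ matrices over the polynomial ring $R[z]$ (with $z$ a central indeterminate), satisfies $f=0$, then $\mathrm{Cen}(\varphi)$ satisfies $f=0$. (2) If $R$ is commutative, then $\mathrm{Cen}(\varphi)$ satisfies the standard identity $S_{2m}=0$ of degree $2m$, where $S_n=\sum_{\sigma\in\mathrm{Sym}(n)}\mathrm{sgn}(\sigma)\,x_{\sigma(1)}x_{\sigma(2)}\cdots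 x_{\sigma(n)}$ (and $S_0=1$). -/

import Mathlib

/-- The standard polynomial `S_n = ∑_{σ ∈ Sym(n)} sgn(σ) x_{σ(0)} x_{σ(1)} ⋯ x_{σ(n-1)}` in the free
associative unital algebra `K⟨x_0, x_1, …⟩`. -/
noncomputable def standardPolynomial (K : Type*) [CommRing K] (n : ℕ) : FreeAlgebra K ℕ :=
  ∑ σ : Equiv.Perm (Fin n),
    ((Equiv.Perm.sign σ : ℤˣ) : ℤ) • (List.ofFn fun i : Fin n => FreeAlgebra.ι K ((σ i : Fin n) : ℕ)).prod

/-- `f = 0` is a polynomial identity of the `K`-algebra `A`: every substitution of elements of `A`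
for the variables of `f ∈ K⟨x_0, x_1, …⟩` gives `0`. -/
def IsPolynomialIdentity (K : Type*) [CommRing K] (A : Type*) [Ring A] [Algebra K A]
    (f : FreeAlgebra K ℕ) : Prop :=
  ∀ a : ℕ → A, FreeAlgebra.lift K a f = 0

/-- The centralizer `Cen(φ) = {ψ | ψ ∘ φ = φ ∘ ψ}` of an endomorphism `φ` of a left `R`-module, as a
`Z(R)`-subalgebra of `Hom_R(M, M)`. -/
def Cen {R : Type*} [Ring R] {M : Type*} [AddCommGroup M] [Module R M] (φ : Module.End R M) :
    Subalgebra (Subring.center R) (Module.End R M) :=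
  Subalgebra.centralizer (Subring.center R) {φ}

/-! Let `R[X]` act on `M` with `X` acting as `φ`. The cokernel of `φ` has the same finite length `m`
as the kernel and is semisimple, so `m` elements generate it; by nilpotency, lifts of them generate
`M` over `R[X]`. An endomorphism commuting with `φ` is `R[X]`-linear, hence described by an `m × m`
matrix over `R[X]`. The matrix is not unique, but composites are represented by products in reversed
order, so identities of the opposite matrix algebra pass to `Cen φ`. For commutative `R` it remains
to prove Amitsur–Levitzki. This follows Rosset: a matrix of anticommuting vectors has a square with
commuting entries, whose powers are traceless, so it is nilpotent; the top exterior coefficient of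
the vanishing power is the standard polynomial. -/

/-! ### Nilpotency from vanishing traces of powers. -/

namespace Matrix

variable {n C : Type*} [Fintype n] [DecidableEq n] [CommRing C]

open Polynomial

theorem derivative_det (A : Matrix n n C[X]) :
    derivative A.det = ∑ i, (A.updateRow i fun j => derivative (A i j)).det := by
  have hrow : ∀ B : Matrix n n C[X], B.det = ∑ σ : Equiv.Perm n, (σ.sign : ℤ) * ∏ i, B i (σ i) :=
    fun B => by rw [← det_transpose, det_apply']; rfl
  simp_rw [hrow, map_sum]
  rw [Finset.sum_comm]
  refine Finset.sum_congr rfl fun σ _ => ?_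
  rw [derivative_intCast_mul, derivative_prod_finset, Finset.mul_sum]
  refine Finset.sum_congr rfl fun i _ => ?_
  rw [← Finset.mul_prod_erase _ _ (Finset.mem_univ i), mul_comm (∏ _ ∈ _, _)]
  simp only [updateRow_self]
  congr 2
  refine Finset.prod_congr rfl fun j hj => ?_
  rw [updateRow_ne (Finset.ne_of_mem_erase hj)]

theorem derivative_charpoly (M : Matrix n n C) :
    derivative M.charpoly = (adjugate M.charmatrix).trace := by
  rw [charpoly, derivative_det, trace]
  refine Finset.sum_congr rfl fun i _ => ?_
  rw [diag_apply, adjugate_apply]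
  congr 2
  ext j : 1
  by_cases h : i = j
  · subst h; simp [charmatrix_apply_eq]
  · simp [charmatrix_apply_ne _ _ _ h, Ne.symm h]

/-- With `p` the characteristic polynomial and `B` the adjugate of `X - M`, compare coefficients in
`(X - M) * B = p`. Since `p'` is the trace of `B`, taking traces gives `(n - k) p_k = 0`; thus `p =
X ^ n`, and Cayley–Hamilton applies. -/
theorem pow_card_eq_zero_of_trace_pow_eq_zero [Algebra ℚ C] (M : Matrix n n C)
    (h : ∀ k, (M ^ (k + 1)).trace = 0) : M ^ Fintype.card n = 0 := by
  nontriviality C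
  set B := matPolyEquiv (adjugate M.charmatrix) with hB
  set p := M.charpoly with hp
  have hmul : (X - Polynomial.C M) * B = p.map (algebraMap C (Matrix n n C)) := by
    rw [← matPolyEquiv_charmatrix, hB, ← map_mul, mul_adjugate, ← charpoly,
      matPolyEquiv_smul_one]
  have hcoeff : ∀ k, (B.coeff k).trace = p.coeff (k + 1) * (k + 1) := by
    intro k
    rw [← coeff_derivative, hp, derivative_charpoly, hB]
    simp [trace, matPolyEquiv_coeff_apply]
  have hrec : ∀ k, B.coeff k - M * B.coeff (k + 1) = p.coeff (k + 1) • 1 := by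
    intro k
    have := congrArg (fun q => q.coeff (k + 1)) hmul
    simpa [sub_mul, coeff_X_mul, coeff_C_mul, Algebra.algebraMap_eq_smul_one] using this
  have hzero : -(M * B.coeff 0) = p.coeff 0 • 1 := by
    have := congrArg (fun q => q.coeff 0) hmul
    simpa [sub_mul, coeff_C_mul, Algebra.algebraMap_eq_smul_one] using this
  -- Each shift changes the trace by a multiple of the trace of a power of `M`, so the index can be
  -- pushed past the degree of `B`.
  have hstep : ∀ d j k, (M ^ (j + 1) * B.coeff k).trace
      = (M ^ (j + d + 1) * B.coeff (k + d)).trace := by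
    intro d
    induction d with
    | zero => simp
    | succ d ih =>
      intro j k
      rw [ih, sub_eq_iff_eq_add.mp (hrec (k + d)), mul_add, trace_add, ← mul_assoc, ← pow_succ]
      simp [h, ← add_assoc]
  have hMB : ∀ k, (M * B.coeff k).trace = 0 := by
    intro k
    have := hstep (B.natDegree + 1) 0 k
    rwa [coeff_eq_zero_of_natDegree_lt (show B.natDegree < k + (B.natDegree + 1) by omega),
      mul_zero, trace_zero, zero_add, pow_one] at this
  have hp0 : ∀ k, k ≠ Fintype.card n → p.coeff k = 0 := by
    intro k hk
    have key : ((Fintype.card n : ℚ) - k) • p.coeff k = 0 := by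
      rw [sub_smul, Nat.cast_smul_eq_nsmul, Nat.cast_smul_eq_nsmul, nsmul_eq_mul, nsmul_eq_mul]
      cases k with
      | zero =>
        have := congrArg trace hzero
        rw [trace_neg, hMB] at this
        simpa [mul_comm] using this.symm
      | succ k =>
        have := congrArg trace (hrec k)
        rw [trace_sub, hMB, hcoeff] at this
        simp only [sub_zero, trace_smul, trace_one, smul_eq_mul] at this
        push_cast
        linear_combination -this
    refine (smul_eq_zero_iff_right ?_).mp key
    rw [sub_ne_zero]
    exact_mod_cast hk.symm
  have hpX : p = X ^ Fintype.card n := by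
    ext k
    rw [coeff_X_pow]
    split_ifs with hk
    · rw [hk, hp, ← charpoly_natDegree_eq_dim M]
      exact charpoly_monic M
    · exact hp0 k hk
  simpa [← hp, hpX] using aeval_self_charpoly M

end Matrix

/-! ### Generators of semisimple modules; the cokernel of `φ`. -/

/-- The length counts the simple summands, and each of them is cyclic. -/
theorem Module.exists_fin_span_eq_top_of_length {R M : Type*} [Ring R] [AddCommGroup M]
    [Module R M] [Module.Finite R M] [IsSemisimpleModule R M] {m : ℕ}
    (h : Module.length R M = m) : ∃ v : Fin m → M, Submodule.span R (Set.range v) = ⊤ := by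
  obtain ⟨n, S, e, hS⟩ := IsSemisimpleModule.exists_linearEquiv_fin_dfinsupp R M
  have e' := e.trans DFinsupp.linearEquivFunOnFintype
  have hn : n = m := by
    have := e'.length_eq
    rw [h, Module.length_pi_of_fintype] at this
    simp only [Module.length_eq_one, Finset.sum_const, Finset.card_univ, Fintype.card_fin,
      nsmul_eq_mul, mul_one] at this
    exact_mod_cast this.symm
  subst hn
  have hx : ∀ i, ∃ x : S i, Submodule.span R {x} = ⊤ := fun i => by
    have := IsSimpleModule.nontrivial R (S i)
    obtain ⟨x, hx⟩ := exists_ne (0 : S i)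
    exact ⟨x, IsSimpleModule.span_singleton_eq_top R hx⟩
  choose x hx using hx
  refine ⟨fun i => e'.symm (Pi.single i (x i)), eq_top_iff.mpr fun y _ => ?_⟩
  have hc : ∀ i, ∃ c : R, c • x i = e' y i := fun i =>
    Submodule.mem_span_singleton.mp (hx i ▸ Submodule.mem_top)
  choose c hc using hc
  have hy : y = ∑ i, c i • e'.symm (Pi.single i (x i)) := by
    apply e'.injective
    simp [map_sum, ← Pi.single_smul, hc, Finset.univ_sum_single]
  rw [hy]
  exact Submodule.sum_mem _ fun i _ =>
    Submodule.smul_mem _ _ (Submodule.subset_span ⟨i, rfl⟩)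

theorem LinearMap.length_quotient_range {R M : Type*} [Ring R] [AddCommGroup M] [Module R M]
    [IsArtinian R M] [IsNoetherian R M] (φ : Module.End R M) :
    Module.length R (M ⧸ LinearMap.range φ) = Module.length R (LinearMap.ker φ) := by
  have h₁ := Module.length_eq_add_of_exact (LinearMap.ker φ).subtype φ.rangeRestrict
    (Submodule.subtype_injective _) φ.surjective_rangeRestrict
    (LinearMap.exact_iff.mpr (by simp))
  have h₂ := Module.length_eq_add_of_exact (LinearMap.range φ).subtype (LinearMap.range φ).mkQ
    (Submodule.subtype_injective _) (Submodule.mkQ_surjective _)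
    (LinearMap.exact_iff.mpr (by simp))
  rw [h₁, add_comm] at h₂
  exact ((ENat.addLECancellable_of_ne_top Module.length_ne_top).inj.mp h₂).symm

/-- Nakayama's lemma for a nilpotent endomorphism: a `φ`-stable submodule that generates `M` modulo
the range of `φ` is all of `M`. -/
theorem Submodule.eq_top_of_sup_range_eq_top {R M : Type*} [Ring R] [AddCommGroup M] [Module R M]
    {φ : Module.End R M} (hφ : IsNilpotent φ) {N : Submodule R M} (hN : N ≤ N.comap φ)
    (h : N ⊔ LinearMap.range φ = ⊤) : N = ⊤ := by
  obtain ⟨k, hk⟩ := hφ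
  have key : ∀ j, N ⊔ LinearMap.range (φ ^ j) = ⊤ := by
    intro j
    induction j with
    | zero => simp [Module.End.one_eq_id]
    | succ j ih =>
      rw [eq_top_iff, ← h]
      refine sup_le le_sup_left ?_
      rintro _ ⟨x, rfl⟩
      obtain ⟨y, hy, _, ⟨z, rfl⟩, rfl⟩ := Submodule.mem_sup.mp (ih ▸ Submodule.mem_top (x := x))
      rw [map_add, ← Module.End.mul_apply, ← pow_succ']
      exact add_mem (mem_sup_left (hN hy)) (mem_sup_right ⟨z, rfl⟩)
  simpa [hk] using key k

/-! ### Matrices over `R[X]` representing the centralizer. -/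

section PolynomialAction

open Polynomial

/-- The action of `R[X]` on `M` in which `X` acts as `φ`. -/
noncomputable def polynomialAction {R M : Type*} [Ring R] [AddCommGroup M] [Module R M]
    (φ : Module.End R M) : R[X] →+* AddMonoid.End M :=
  Polynomial.eval₂RingHom' (Module.toAddMonoidEnd R M) φ.toAddMonoidHom fun a =>
    AddMonoidHom.ext fun x => (φ.map_smul a x).symm

variable {R M : Type*} [Ring R] [AddCommGroup M] [Module R M] (φ : Module.End R M)

@[simp]
theorem polynomialAction_C (a : R) (x : M) : polynomialAction φ (C a) x = a • x :=
  DFunLike.congr_fun (eval₂_C (S := AddMonoid.End M) (Module.toAddMonoidEnd R M)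
    φ.toAddMonoidHom) x

@[simp]
theorem polynomialAction_X (x : M) : polynomialAction φ X x = φ x :=
  DFunLike.congr_fun (eval₂_X (S := AddMonoid.End M) (Module.toAddMonoidEnd R M)
    φ.toAddMonoidHom) x

@[simp]
theorem polynomialAction_add (p q : R[X]) (x : M) :
    polynomialAction φ (p + q) x = polynomialAction φ p x + polynomialAction φ q x := by
  rw [map_add]; rfl

@[simp]
theorem polynomialAction_mul (p q : R[X]) (x : M) :
    polynomialAction φ (p * q) x = polynomialAction φ p (polynomialAction φ q x) := by
  rw [map_mul]; rfl

@[simp]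
theorem polynomialAction_one (x : M) : polynomialAction φ 1 x = x := by
  rw [map_one]; rfl

@[simp]
theorem polynomialAction_zero (x : M) : polynomialAction φ 0 x = 0 := by
  rw [map_zero]; rfl

theorem polynomialAction_sum {ι : Type*} (s : Finset ι) (p : ι → R[X]) (x : M) :
    polynomialAction φ (∑ i ∈ s, p i) x = ∑ i ∈ s, polynomialAction φ (p i) x := by
  rw [map_sum]; exact AddMonoidHom.finsetSum_apply _ _ _

theorem map_polynomialAction {ψ : Module.End R M} (hψ : ψ * φ = φ * ψ) (p : R[X]) (x : M) :
    ψ (polynomialAction φ p x) = polynomialAction φ p (ψ x) := by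
  induction p using Polynomial.induction_on' generalizing x with
  | add p q hp hq => simp [-map_add, hp, hq, map_add ψ]
  | monomial k a =>
    rw [← C_mul_X_pow_eq_monomial]
    induction k generalizing x with
    | zero => simp
    | succ k ih =>
      rw [pow_succ, ← mul_assoc, polynomialAction_mul _ _ X, polynomialAction_mul _ _ X, ih,
        polynomialAction_X, polynomialAction_X, ← Module.End.mul_apply, hψ, Module.End.mul_apply]

theorem exists_eq_sum_polynomialAction {φ} (hφ : IsNilpotent φ) {ι : Type*} [Fintype ι] {v : ι → M}
    (hv : Submodule.span R (Set.range v) ⊔ LinearMap.range φ = ⊤) (x : M) :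
    ∃ p : ι → R[X], x = ∑ i, polynomialAction φ (p i) (v i) := by
  classical
  let N : Submodule R M :=
    { carrier := {x | ∃ p : ι → R[X], x = ∑ i, polynomialAction φ (p i) (v i)}
      zero_mem' := ⟨0, by simp⟩
      add_mem' := by
        rintro _ _ ⟨p, rfl⟩ ⟨q, rfl⟩
        exact ⟨p + q, by simp [-map_add, Finset.sum_add_distrib]⟩
      smul_mem' := by
        rintro a _ ⟨p, rfl⟩
        exact ⟨fun i => C a * p i, by simp [Finset.smul_sum]⟩ }
  have hN : N ≤ N.comap φ := by
    rintro _ ⟨p, rfl⟩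
    exact ⟨fun i => X * p i, by simp⟩
  have hvN : Submodule.span R (Set.range v) ≤ N := by
    rw [Submodule.span_le]
    rintro _ ⟨i, rfl⟩
    refine ⟨Pi.single i 1, ?_⟩
    rw [Finset.sum_eq_single i (by simp +contextual) (by simp)]
    simp
  have htop := Submodule.eq_top_of_sup_range_eq_top hφ hN
    (eq_top_iff.mpr (hv ▸ sup_le_sup_right hvN _))
  exact (htop ▸ Submodule.mem_top : x ∈ N)

/-- The matrix `P` over `R[X]` represents the endomorphism `ψ` on the family `v`. -/
def Represents {ι : Type*} [Fintype ι] (v : ι → M) (P : (Matrix ι ι R[X])ᵐᵒᵖ)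
    (ψ : Module.End R M) : Prop :=
  ∀ i, ψ (v i) = ∑ j, polynomialAction φ (P.unop i j) (v j)

variable {φ}

/-- Representation is only a relation, so `v` need not be independent. The opposite algebra appears
because `ψ` moves past polynomial coefficients: expanding the inner map first puts its matrix on the
left. -/
theorem Represents.lift {ι : Type*} [Fintype ι] [DecidableEq ι] {v : ι → M}
    {P : ℕ → (Matrix ι ι R[X])ᵐᵒᵖ} {ψ : ℕ → Cen φ}
    (h : ∀ k, Represents φ v (P k) (ψ k : Module.End R M))
    (f : FreeAlgebra (Subring.center R) ℕ) :
    Represents φ v (FreeAlgebra.lift (Subring.center R) P f)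
      (FreeAlgebra.lift (Subring.center R) ψ f : Cen φ) := by
  induction f using FreeAlgebra.induction with
  | grade0 r =>
    intro i
    rw [AlgHom.commutes, AlgHom.commutes, Finset.sum_eq_single i]
    · simp [Matrix.algebraMap_matrix_apply, MulOpposite.algebraMap_apply,
        Polynomial.algebraMap_apply]
    · intro j _ hj
      simp [Matrix.algebraMap_matrix_apply, MulOpposite.algebraMap_apply, hj.symm]
    · simp
  | grade1 k => simpa using h k
  | mul f g hf hg =>
    intro i
    have hc := (Subalgebra.mem_centralizer_iff _).mp
      (FreeAlgebra.lift (Subring.center R) ψ f).2 φ rfl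
    simp only [map_mul, Subalgebra.coe_mul, Module.End.mul_apply, MulOpposite.unop_mul,
      Matrix.mul_apply]
    have hact : ∀ p q : ι → R[X], ∀ x, polynomialAction φ (∑ j, p j * q j) x
        = ∑ j, polynomialAction φ (p j) (polynomialAction φ (q j) x) := fun p q x => by
      simp_rw [polynomialAction_sum, polynomialAction_mul]
    rw [hg i, map_sum, Finset.sum_congr rfl fun k _ => hact (fun j => (FreeAlgebra.lift _ P g).unop i j)
      (fun j => (FreeAlgebra.lift _ P f).unop j k) (v k), Finset.sum_comm]
    refine Finset.sum_congr rfl fun j _ => ?_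
    rw [map_polynomialAction φ hc.symm, hf j, map_sum]
  | add f g hf hg =>
    intro i
    simp [-map_add, map_add (FreeAlgebra.lift _ _), hf i, hg i, Finset.sum_add_distrib]

theorem IsPolynomialIdentity.cen_of_matrix (hφ : IsNilpotent φ) {ι : Type*} [Fintype ι]
    [DecidableEq ι] {v : ι → M}
    (hv : Submodule.span R (Set.range v) ⊔ LinearMap.range φ = ⊤)
    {f : FreeAlgebra (Subring.center R) ℕ}
    (hf : IsPolynomialIdentity (Subring.center R) (Matrix ι ι R[X])ᵐᵒᵖ f) :
    IsPolynomialIdentity (Subring.center R) (Cen φ) f := by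
  intro ψ
  have hgen := exists_eq_sum_polynomialAction hφ hv
  choose P hP using fun k i => hgen ((ψ k : Module.End R M) (v i))
  have hrep := Represents.lift (P := fun k => MulOpposite.op (Matrix.of (P k)))
    (ψ := ψ) (v := v) hP f
  rw [hf] at hrep
  have hc := (Subalgebra.mem_centralizer_iff _).mp
    (FreeAlgebra.lift (Subring.center R) ψ f).2 φ rfl
  refine Subtype.ext (LinearMap.ext fun x => ?_)
  obtain ⟨p, rfl⟩ := hgen x
  rw [map_sum]
  refine Finset.sum_eq_zero fun i _ => ?_
  rw [map_polynomialAction φ hc.symm, hrep i]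
  simp

theorem exists_fin_span_sup_range_eq_top [Module.Finite R M] [IsSemisimpleModule R M]
    (φ : Module.End R M) {m : ℕ} (hm : Module.length R (LinearMap.ker φ) = m) :
    ∃ v : Fin m → M, Submodule.span R (Set.range v) ⊔ LinearMap.range φ = ⊤ := by
  obtain ⟨w, hw⟩ := Module.exists_fin_span_eq_top_of_length
    ((LinearMap.length_quotient_range φ).trans hm)
  choose v hv using fun i => Submodule.mkQ_surjective _ (w i)
  refine ⟨v, ?_⟩
  rw [← (LinearMap.range φ).ker_mkQ, ← Submodule.comap_map_eq, Submodule.map_span, ← Set.range_comp]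
  rw [show ⇑(LinearMap.range φ).mkQ ∘ v = w from funext hv, hw, Submodule.comap_top]

end PolynomialAction

/-! ### The commutative subalgebra of even elements. -/

namespace ExteriorAlgebra

variable (K V : Type*) [CommRing K] [AddCommGroup V] [Module K V]

/-- The subalgebra of the exterior algebra generated by products of two vectors. -/
def pairSubalgebra : Subalgebra K (ExteriorAlgebra K V) :=
  Algebra.adjoin K (Set.range fun x : V × V => ι K x.1 * ι K x.2)

variable {K V}

theorem ι_mul_ι_comm (u v : V) : ι K u * ι K v = -(ι K v * ι K u) :=
  eq_neg_of_add_eq_zero_left (ι_add_mul_swap u v)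

/-- Passing a vector across a product of two vectors changes the sign twice. -/
theorem commute_ι_of_mem_pairSubalgebra (u : V) {e : ExteriorAlgebra K V}
    (he : e ∈ pairSubalgebra K V) : Commute (ι K u) e := by
  induction he using Algebra.adjoin_induction with
  | mem _ h =>
    obtain ⟨⟨v, w⟩, rfl⟩ := h
    change _ * (ι K v * ι K w) = (ι K v * ι K w) * _
    rw [← mul_assoc, ι_mul_ι_comm u v, mul_assoc (ι K v), ι_mul_ι_comm w u]
    noncomm_ring
  | algebraMap r => exact (Algebra.commutes r _).symm
  | add _ _ _ _ h₁ h₂ => exact h₁.add_right h₂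
  | mul _ _ _ _ h₁ h₂ => exact h₁.mul_right h₂

instance : IsMulCommutative (pairSubalgebra K V) :=
  Algebra.isMulCommutative_adjoin K (by
    rintro _ ⟨⟨u, v⟩, rfl⟩ b hb
    have h := fun w => commute_ι_of_mem_pairSubalgebra w
      (Algebra.subset_adjoin hb : b ∈ pairSubalgebra K V)
    exact (h u).mul_left (h v))

end ExteriorAlgebra

/-! ### Rosset's proof of the Amitsur–Levitzki theorem. -/

section AmitsurLevitzki

open ExteriorAlgebra Matrix
open scoped IsMulCommutative

variable {K V n : Type*} [CommRing K] [AddCommGroup V] [Module K V] [Fintype n] [DecidableEq n]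

/-- Rosset's lemma: a matrix of vectors has vanishing `2n`-th power over the exterior algebra. -/
theorem ExteriorAlgebra.matrix_pow_eq_zero [Algebra ℚ K] (u : Matrix n n V) :
    (u.map (ι K)) ^ (2 * Fintype.card n) = 0 := by
  let : Algebra ℚ (pairSubalgebra K V) :=
    ((algebraMap K (pairSubalgebra K V)).comp (algebraMap ℚ K)).toAlgebra
  set A := u.map (ι K) with hA
  let Q : Matrix n n (pairSubalgebra K V) := fun i j =>
    ⟨(A * A) i j, by
      rw [mul_apply]
      exact sum_mem fun k _ => Algebra.subset_adjoin ⟨(u i k, u k j), rfl⟩⟩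
  have hQ : ∀ k, (Q ^ k).map (pairSubalgebra K V).val = A ^ (2 * k) := by
    intro k
    have : Q.map (pairSubalgebra K V).val = A ^ 2 := by rw [sq]; rfl
    rw [pow_mul, ← this]
    exact map_pow (pairSubalgebra K V).val.toRingHom.mapMatrix Q k
  have htr : ∀ k, (Q ^ (k + 1)).trace = 0 := by
    intro k
    -- Cyclicity of the trace acquires a sign: the entries of the two outer factors `A` anticommute,
    -- while those of `A ^ (2 * k)` are even, hence commute with them.
    have hanti : (A * (A * A ^ (2 * k))).trace = -(A * (A * A ^ (2 * k))).trace := by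
      conv_rhs => rw [← mul_assoc, ← pow_two, ← pow_add, add_comm, pow_add, pow_two, ← mul_assoc,
        ← pow_succ, pow_succ', trace, ← Finset.sum_neg_distrib]
      simp only [trace, diag_apply, mul_apply (M := A), mul_apply (N := A), ← Finset.sum_neg_distrib]
      rw [Finset.sum_comm]
      refine Finset.sum_congr rfl fun i _ => Finset.sum_congr rfl fun j _ => ?_
      rw [Finset.mul_sum, Finset.sum_mul, ← Finset.sum_neg_distrib]
      refine Finset.sum_congr rfl fun l _ => ?_
      have hmem : (A ^ (2 * k)) l j ∈ pairSubalgebra K V := by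
        rw [← hQ k]; exact ((Q ^ k) l j).2
      have h := fun w => (commute_ι_of_mem_pairSubalgebra w hmem).eq
      simp only [hA, map_apply] at h ⊢
      rw [← mul_assoc, ι_mul_ι_comm, neg_mul, mul_assoc, h, mul_assoc]
    have h0 : (A * (A * A ^ (2 * k))).trace = 0 := by
      have : Module ℚ (ExteriorAlgebra K V) := Module.compHom _ (algebraMap ℚ K)
      have : IsAddTorsionFree (ExteriorAlgebra K V) := IsAddTorsionFree.of_module_rat _
      exact self_eq_neg.mp hanti
    rw [← mul_assoc, ← sq, ← pow_add, add_comm, ← Nat.mul_succ, ← hQ] at h0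
    apply Subtype.ext
    rw [← AddMonoidHom.map_trace] at h0
    exact h0
  rw [← hQ, pow_card_eq_zero_of_trace_pow_eq_zero Q htr]
  ext; simp

theorem sum_pow_eq_sum_ofFn_prod {A ι : Type*} [Ring A] [Fintype ι] (a : ι → A) (N : ℕ) :
    (∑ k, a k) ^ N = ∑ f : Fin N → ι, (List.ofFn fun i => a (f i)).prod := by
  classical
  have := (MultilinearMap.mkPiAlgebraFin ℤ N A).map_sum fun (_ : Fin N) k => a k
  simpa [MultilinearMap.mkPiAlgebraFin_apply, List.prod_ofFn] using this

theorem List.prod_ofFn_mul_of_commute {A : Type*} [Monoid A] {N : ℕ} (b e : Fin N → A)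
    (h : ∀ i j, Commute (e i) (b j)) :
    (List.ofFn fun i => b i * e i).prod = (List.ofFn b).prod * (List.ofFn e).prod := by
  induction N with
  | zero => simp
  | succ N ih =>
    simp only [List.ofFn_succ, List.prod_cons]
    rw [ih _ _ fun i j => h _ _]
    have hc : Commute (e 0) (List.ofFn fun i : Fin N => b i.succ).prod :=
      Commute.list_prod_right _ _ fun x hx => by
        obtain ⟨i, rfl⟩ := (List.mem_ofFn' _ _).mp hx
        exact h _ _
    rw [mul_assoc, mul_assoc, ← mul_assoc (e 0), hc.eq, mul_assoc]

theorem ExteriorAlgebra.exists_linearMap_ιMulti_eq_det (K : Type*) [CommRing K] (N : ℕ) :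
    ∃ L : ExteriorAlgebra K (Fin N → K) →ₗ[K] K, ∀ v, L (ιMulti K N v) = (Matrix.of v).det := by
  classical
  refine ⟨liftAlternating fun i => if h : i = N then
    h ▸ (Matrix.detRowAlternating : (Fin N → K) [⋀^Fin N]→ₗ[K] K) else 0, fun v => ?_⟩
  rw [liftAlternating_apply_ιMulti]
  simp
  rfl

/-- The standard polynomial of degree `N`, evaluated at `a`. -/
def standardSum {A : Type*} [Ring A] {N : ℕ} (a : Fin N → A) : A :=
  ∑ σ : Equiv.Perm (Fin N), ((Equiv.Perm.sign σ : ℤˣ) : ℤ) • (List.ofFn fun i => a (σ i)).prod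

theorem map_standardSum {A B F : Type*} [Ring A] [Ring B] [FunLike F A B] [RingHomClass F A B]
    (g : F) {N : ℕ} (a : Fin N → A) : g (standardSum a) = standardSum fun i => g (a i) := by
  simp [standardSum, map_list_prod, List.map_ofFn, Function.comp_def]

/-- Apply Rosset's lemma to `∑ a_k e_k`, with `e_k` the standard basis. In its `N`-th power only
words using every `e_k` once contribute to the top form, each with the sign of its permutation. -/
theorem Matrix.standardSum_eq_zero_of_algebra_rat [Algebra ℚ K] {N : ℕ}
    (hN : N = 2 * Fintype.card n) (a : Fin N → Matrix n n K) : standardSum a = 0 := by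
  obtain ⟨L, hL⟩ := exists_linearMap_ιMulti_eq_det K N
  let E := ExteriorAlgebra K (Fin N → K)
  let v : Fin N → Fin N → K := fun k => Pi.single k 1
  have hsum : ((Matrix.of fun i j k => a k i j).map (ι K) : Matrix n n E)
      = ∑ k, (a k).map (algebraMap K E) * scalar n (ι K (v k)) := by
    ext i j
    have : (fun k => a k i j) = ∑ k, a k i j • v k := by
      ext l; simp [v, Finset.sum_apply, Pi.single_apply]
    simp only [map_apply, of_apply, this, map_sum, map_smul, sum_apply, scalar_apply,
      mul_diagonal]
    exact Finset.sum_congr rfl fun k _ => Algebra.smul_def _ _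
  have hpow := ExteriorAlgebra.matrix_pow_eq_zero (K := K)
    (Matrix.of fun i j k => a k i j : Matrix n n (Fin N → K))
  rw [hsum, ← hN, sum_pow_eq_sum_ofFn_prod] at hpow
  have hterm : ∀ f : Fin N → Fin N,
      (List.ofFn fun i => (a (f i)).map (algebraMap K E) * scalar n (ι K (v (f i)))).prod
      = ((List.ofFn fun i => a (f i)).prod).map (algebraMap K E) *
        scalar n (ιMulti K N (v ∘ f)) := by
    intro f
    rw [List.prod_ofFn_mul_of_commute (fun i => (a (f i)).map (algebraMap K E))
      (fun i => scalar n (ι K (v (f i)))), ιMulti_apply, map_list_prod, List.map_ofFn]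
    · congr 1
      have := map_list_prod (algebraMap K E).mapMatrix (List.ofFn fun i => a (f i))
      rw [List.map_ofFn] at this
      exact this.symm
    · intro i j
      exact scalar_commute_iff.mpr (Matrix.ext fun k l =>
        (Algebra.commutes (a (f j) k l) (ι K (v (f i)))).symm)
  rw [Finset.sum_congr rfl fun f _ => hterm f] at hpow
  ext i j
  have hij := congrArg (fun P : Matrix n n E => L (P i j)) hpow
  simp only [sum_apply, map_sum, scalar_apply, mul_diagonal, map_apply, zero_apply,
    map_zero, ← Algebra.smul_def, map_smul, hL, smul_eq_mul] at hij
  rw [zero_apply, ← hij, standardSum, sum_apply]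
  have hdet : ∀ f : Fin N → Fin N, ¬ Function.Bijective f → (Matrix.of (v ∘ f)).det = 0 := by
    intro f hf
    rw [← Finite.injective_iff_bijective, Function.Injective] at hf
    push Not at hf
    obtain ⟨k, l, hkl, hne⟩ := hf
    exact det_zero_of_row_eq hne (by ext; simp [hkl])
  rw [← Finset.sum_subset (Finset.filter_subset (fun f : Fin N → Fin N => Function.Bijective f) _)
    fun f _ hf => by rw [hdet f (by simpa using hf), mul_zero]]
  symm
  refine Finset.sum_bij (fun p h => Equiv.ofBijective p (Finset.mem_filter.1 h).2)
    (fun _ _ => Finset.mem_univ _) (fun _ _ _ _ h => by injection h)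
    (fun b _ => ⟨b, Finset.mem_filter.2 ⟨Finset.mem_univ _, b.bijective⟩,
      Equiv.coe_fn_injective rfl⟩) fun f hf => ?_
  have hfdet : (Matrix.of (v ∘ f)).det
      = ((Equiv.Perm.sign (Equiv.ofBijective f (Finset.mem_filter.1 hf).2) : ℤˣ) : ℤ) := by
    rw [← det_permutation]
    congr 1
    ext k l
    simp [v, Pi.single_apply, PEquiv.toMatrix_apply, Equiv.toPEquiv_apply, eq_comm]
  rw [hfdet, smul_apply, zsmul_eq_mul, mul_comm]
  rfl

/-- The Amitsur–Levitzki theorem. -/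
theorem Matrix.standardSum_eq_zero (a : Fin (2 * Fintype.card n) → Matrix n n K) :
    standardSum a = 0 := by
  -- The rational case suffices: generic matrices over `ℤ[x]` embed into those over `ℚ[x]` and
  -- specialize to any commutative ring.
  let σ := Fin (2 * Fintype.card n) × n × n
  let g : Fin (2 * Fintype.card n) → Matrix n n (MvPolynomial σ ℤ) :=
    fun k => Matrix.of fun i j => MvPolynomial.X (k, i, j)
  have hg : standardSum g = 0 := by
    let F := (MvPolynomial.map (σ := σ) (Int.castRingHom ℚ)).mapMatrix (m := n)
    have hF : Function.Injective F :=
      Matrix.map_injective (MvPolynomial.map_injective _ Int.cast_injective)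
    apply hF
    rw [map_standardSum, map_zero, standardSum_eq_zero_of_algebra_rat rfl]
  let ev : MvPolynomial σ ℤ →+* K :=
    MvPolynomial.eval₂Hom (Int.castRingHom K) fun x => a x.1 x.2.1 x.2.2
  have ha : (fun k => ev.mapMatrix (g k)) = a := by
    ext k i j
    simp [ev, g]
  rw [← ha, ← map_standardSum (ev.mapMatrix (m := n)), hg, map_zero]

end AmitsurLevitzki

/-! ### Transfer to the opposite matrix algebra and conclusion. -/

theorem lift_standardPolynomial {K A : Type*} [CommRing K] [Ring A] [Algebra K A] (a : ℕ → A)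
    (n : ℕ) : FreeAlgebra.lift K a (standardPolynomial K n) = standardSum fun i : Fin n => a i := by
  simp [standardPolynomial, standardSum, map_list_prod, List.map_ofFn, Function.comp_def]

theorem isPolynomialIdentity_standardPolynomial_matrix_mulOpposite {R : Type*} [Ring R]
    (hR : ∀ a b : R, a * b = b * a) (m : ℕ) :
    IsPolynomialIdentity (Subring.center R) (Matrix (Fin m) (Fin m) (Polynomial R))ᵐᵒᵖ
      (standardPolynomial (Subring.center R) (2 * m)) := by
  let : CommRing R := { ‹Ring R› with mul_comm := hR }
  intro a
  rw [lift_standardPolynomial]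
  -- Over a commutative ring, transposition identifies the matrix algebra with its opposite.
  let e := Matrix.transposeRingEquiv (Fin m) (Polynomial R)
  apply e.symm.injective
  rw [map_standardSum, map_zero]
  have key : ∀ N, N = 2 * Fintype.card (Fin m) →
      ∀ b : Fin N → Matrix (Fin m) (Fin m) (Polynomial R), standardSum b = 0 := by
    rintro _ rfl b
    exact Matrix.standardSum_eq_zero b
  exact key _ (by simp) _

theorem corollary4p9 {R : Type*} [Ring R] {M : Type*} [AddCommGroup M] [Module R M]
    [Module.Finite R M] [IsSemisimpleModule R M] (φ : Module.End R M) (hφ : IsNilpotent φ) :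
    ∃ m : ℕ, Module.length R (LinearMap.ker φ) = m ∧
      (∀ f : FreeAlgebra (Subring.center R) ℕ,
        IsPolynomialIdentity (Subring.center R) (Matrix (Fin m) (Fin m) (Polynomial R))ᵐᵒᵖ f →
          IsPolynomialIdentity (Subring.center R) (Cen φ) f) ∧
      ((∀ a b : R, a * b = b * a) →
        IsPolynomialIdentity (Subring.center R) (Cen φ)
          (standardPolynomial (Subring.center R) (2 * m))) := by
  obtain ⟨m, hm⟩ := ENat.ne_top_iff_exists.mp (Module.length_ne_top (R := R) (M := LinearMap.ker φ))
  obtain ⟨v, hv⟩ := exists_fin_span_sup_range_eq_top φ hm.symm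
  exact ⟨m, hm.symm, fun f hf => hf.cen_of_matrix hφ hv, fun hR =>
    (isPolynomialIdentity_standardPolynomial_matrix_mulOpposite hR m).cen_of_matrix hφ hv⟩
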